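/- A football graph is a ribbon graph (a graph with a cyclic order on the edge ends at each vertex; loops and multiple edges are allowed) with black and white vertices such that each black vertex has valence five and all its edges lead to white vertices, and each white vertex has valence six and its edges lead alternately, in the cyclic order, to black and white vertices. Coverings and automorphisms of football graphs are understood to respect the cyclic orders and the colours. Let $T$ be the football tree, i.e. the connected and simply connected football graph, and let $\operatorname{Aut}(T)$ be its group of (orientation-preserving) automorphisms. Let $\Gamma_0$ be the standard football graph, i.e. the ribbon graph dual to the truncated icosahedron, whose $12$ black vertices correspond to the pentagons and whose $20$ white vertices correspond to the hexagons. Then $T$ is a universal covering of $\Gamma_0$. For every covering map $\pi_0\colon T\to\Gamma_0$, identify $\pi_1(\Gamma_0)$ with the group of deck transformations $\{\varphi\in\operatorname{Aut}(T) : \pi_0\circ\varphi=\pi_0\}$. Then the subgroup $\pi_1(\Gamma_0)\subset\operatorname{Aut}(T)$ is normal, and the quotient $\operatorname{Aut}(T)/\pi_1(\Gamma_0)$ is the icosahedral group of order $60$, i.e. it is isomorphic to the alternating group $A_5$. -/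

import Mathlib

/-- A football graph with set of darts (oriented edges) `D`: a ribbon graph with black and white
vertices.  `rot` sends a dart to its successor in the cyclic order of the darts with the same
origin, so the vertices are the cycles of `rot`; `inv` is edge inversion, so the (geometric) edges
are the pairs `{d, inv d}`; `black d` says whether the origin of `d` is black.  The valence of the
origin of `d` is the length of the `rot`-cycle of `d`.  Loops, multiple edges and infinitely many
vertices are allowed. -/
structure FootballGraph (D : Type*) where
  rot : Equiv.Perm D
  inv : D → D
  inv_inv : ∀ d, inv (inv d) = d
  inv_ne : ∀ d, inv d ≠ d
  black : D → Bool
  black_rot : ∀ d, black (rot d) = black d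
  /-- a black vertex has valence five -/
  valence_black : ∀ d, black d = true → Function.minimalPeriod rot d = 5
  /-- all edges at a black vertex lead to white vertices -/
  inv_black : ∀ d, black d = true → black (inv d) = false
  /-- a white vertex has valence six -/
  valence_white : ∀ d, black d = false → Function.minimalPeriod rot d = 6
  /-- the edges at a white vertex lead alternately to black and white vertices -/
  alternate : ∀ d, black d = false → black (inv (rot d)) = !black (inv d)

namespace FootballGraph

variable {D E : Type*}

/-- Two darts have the same origin. -/
def SameOrigin (G : FootballGraph D) (d e : D) : Prop := G.rot.SameCycle d e

/-- The graph is nonempty and connected. -/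
def Connected (G : FootballGraph D) : Prop :=
  Nonempty D ∧
    ∀ d e, Relation.ReflTransGen (fun x y => G.SameOrigin x y ∨ y = G.inv x) d e

/-- The dart `e` can follow the dart `d` in an edge path without backtracking: it starts where `d`
ends, and it is not `d` reversed. -/
def ReducedStep (G : FootballGraph D) (d e : D) : Prop :=
  G.SameOrigin (G.inv d) e ∧ e ≠ G.inv d

/-- Every closed edge path without backtracking is trivial (has length zero). -/
def SimplyConnected (G : FootballGraph D) : Prop :=
  ∀ (d : D) (l : List D), List.IsChain G.ReducedStep (d :: l) →
    ¬ G.SameOrigin (G.inv ((d :: l).getLast (List.cons_ne_nil d l))) d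

/-- A football tree: a connected and simply connected football graph. -/
structure IsFootballTree (G : FootballGraph D) : Prop where
  connected : G.Connected
  simplyConnected : G.SimplyConnected

/-- The group of (orientation-preserving) automorphisms of a football graph. -/
def Aut (G : FootballGraph D) : Subgroup (Equiv.Perm D) where
  carrier := {φ | ∀ d, φ (G.rot d) = G.rot (φ d) ∧ φ (G.inv d) = G.inv (φ d) ∧
    G.black (φ d) = G.black d}
  one_mem' := fun d => by simp
  mul_mem' := fun {φ ψ} hφ hψ d => by
    simp only [Equiv.Perm.mul_apply]
    exact ⟨by rw [(hψ d).1, (hφ _).1], by rw [(hψ d).2.1, (hφ _).2.1],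
      by rw [(hφ _).2.2, (hψ d).2.2]⟩
  inv_mem' := fun {φ} hφ d => by
    have h := hφ (φ⁻¹ d)
    rw [show φ (φ⁻¹ d) = d from φ.apply_symm_apply d] at h
    exact ⟨by rw [Equiv.Perm.inv_eq_iff_eq, h.1], by rw [Equiv.Perm.inv_eq_iff_eq, h.2.1],
      h.2.2.symm⟩

/-- A covering map of football graphs: a surjective map compatible with edge inversion, cyclic
orders and colours which maps the darts at each vertex bijectively onto the darts at the image
vertex. -/
structure Covering (G : FootballGraph D) (H : FootballGraph E) where
  toFun : D → E
  map_rot : ∀ d, toFun (G.rot d) = H.rot (toFun d)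
  map_inv : ∀ d, toFun (G.inv d) = H.inv (toFun d)
  map_black : ∀ d, H.black (toFun d) = G.black d
  bijOn_star : ∀ d, Set.BijOn toFun {e | G.SameOrigin d e} {e | H.SameOrigin (toFun d) e}
  surjective : Function.Surjective toFun

/-- The group of deck transformations of a covering `p : G → H`, as a subgroup of `Aut G`.  If `G`
is connected and simply connected, i.e. if `p` is a universal covering, this is the fundamental
group of `H`, acting on its universal covering. -/
def Covering.deck {G : FootballGraph D} {H : FootballGraph E} (p : G.Covering H) :
    Subgroup G.Aut where
  carrier := {φ | ∀ d, p.toFun (φ.1 d) = p.toFun d}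
  one_mem' := fun _ => rfl
  mul_mem' := fun {φ ψ} hφ hψ d => (hφ (ψ.1 d)).trans (hψ d)
  inv_mem' := fun {φ} hφ d => by
    have h := hφ (φ.1⁻¹ d)
    rw [show φ.1 (φ.1⁻¹ d) = d from φ.1.apply_symm_apply d] at h
    exact h.symm

end FootballGraph

/-! ### The standard football

We describe the icosahedron by its darts, and then the graph dual to its truncation. -/

/-- The twelve vertices of the icosahedron: two poles, an upper pentagon (`upper i` at longitude
`72 i` degrees) and a lower pentagon (`lower i` at longitude `72 i + 36` degrees). -/
inductive IcoVertex
  | north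
  | south
  | upper (i : ZMod 5)
  | lower (i : ZMod 5)
  deriving DecidableEq

/-- The sixty oriented edges of the icosahedron; at each vertex the five edges are numbered
counterclockwise (seen from outside) by `ZMod 5`. -/
abbrev IcoDart := IcoVertex × ZMod 5

/-- The next oriented edge with the same origin, counterclockwise. -/
def icoRot : Equiv.Perm IcoDart := Equiv.prodCongr (Equiv.refl _) (Equiv.addRight 1)

/-- Inversion of edges.  Thus the neighbours in counterclockwise order are, starting from number 0:
of `north`: `upper 0, ..., upper 4`; of `south`: `lower 0, lower 4, ..., lower 1`;
of `upper i`: `north, upper (i - 1), lower (i - 1), lower i, upper (i + 1)`;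
of `lower i`: `south, lower (i + 1), upper (i + 1), upper i, lower (i - 1)`. -/
def icoInv : IcoDart → IcoDart
  | (.north, i) => (.upper i, 0)
  | (.south, i) => (.lower (-i), 0)
  | (.upper i, 0) => (.north, i)
  | (.upper i, 1) => (.upper (i - 1), 4)
  | (.upper i, 2) => (.lower (i - 1), 2)
  | (.upper i, 3) => (.lower i, 3)
  | (.upper i, 4) => (.upper (i + 1), 1)
  | (.lower i, 0) => (.south, -i)
  | (.lower i, 1) => (.lower (i + 1), 4)
  | (.lower i, 2) => (.upper (i + 1), 2)
  | (.lower i, 3) => (.upper i, 3)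
  | (.lower i, 4) => (.lower (i - 1), 1)

theorem icoInv_icoInv (d : IcoDart) : icoInv (icoInv d) = d := by
  obtain ⟨v, k⟩ := d
  cases v with
  | north => rfl
  | south => simp [icoInv]
  | upper i => revert i k; decide +revert
  | lower i => revert i k; decide +revert

theorem icoInv_ne (d : IcoDart) : icoInv d ≠ d := by
  obtain ⟨v, k⟩ := d
  cases v with
  | north => simp [icoInv]
  | south => simp [icoInv]
  | upper i => revert i k; decide
  | lower i => revert i k; decide

/-- The face permutation of the icosahedron: the edge following the oriented edge `d` along the
boundary of the face to the left of `d`. -/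
def icoFace (d : IcoDart) : IcoDart := icoRot.symm (icoInv d)

theorem icoFace_cube (d : IcoDart) : icoFace (icoFace (icoFace d)) = d := by
  obtain ⟨v, k⟩ := d
  cases v with
  | north => revert k; decide
  | south => revert k; decide
  | upper i => revert i k; decide
  | lower i => revert i k; decide

theorem icoFace_ne (d : IcoDart) : icoFace d ≠ d := by
  obtain ⟨v, k⟩ := d
  cases v with
  | north => revert k; decide
  | south => revert k; decide
  | upper i => revert i k; decide
  | lower i => revert i k; decide

/-- The faces of the truncated icosahedron are a pentagon for each vertex `v` and a hexagon for each
face `F` of the icosahedron.  They border along an edge for each corner of `F` at `v`, and the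
hexagons of two faces `F`, `F'` border along an edge for each common edge of `F` and `F'`.
Accordingly the dual graph has three darts for each oriented edge `d` of the icosahedron, where
`v` denotes the origin of `d` and `F` the face to the left of `d`:
`toFace d` from (the pentagon of) `v` to (the hexagon of) `F`, `toVertex d` from `F` to `v`, and
`across d` from `F` to the face to the right of `d`. -/
inductive FootballDart
  | toFace (d : IcoDart)
  | toVertex (d : IcoDart)
  | across (d : IcoDart)

namespace FootballDart

/-- The counterclockwise next dart with the same origin: around a vertex `v` one meets in turn the
corners at `v`, and around a face `F` one meets alternately its corners and its edges. -/
def rot : Equiv.Perm FootballDart where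
  toFun
    | toFace d => toFace (icoRot d)
    | toVertex d => across d
    | across d => toVertex (icoFace d)
  invFun
    | toFace d => toFace (icoRot.symm d)
    | toVertex d => across (icoFace (icoFace d))
    | across d => toVertex d
  left_inv d := by cases d <;> simp [icoFace_cube]
  right_inv d := by cases d <;> simp [icoFace_cube]

/-- Inversion of edges. -/
def inv : FootballDart → FootballDart
  | toFace d => toVertex d
  | toVertex d => toFace d
  | across d => across (icoInv d)

/-- The colour of the origin: pentagons are black and hexagons are white. -/
def black : FootballDart → Bool
  | toFace _ => true
  | toVertex _ => false
  | across _ => false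

end FootballDart

theorem minimalPeriod_eq_six {α : Type*} {f : α → α} {x : α} (h : f^[6] x = x)
    (h2 : f^[2] x ≠ x) (h3 : f^[3] x ≠ x) : Function.minimalPeriod f x = 6 := by
  have hd : Function.minimalPeriod f x ∣ 6 := Function.IsPeriodicPt.minimalPeriod_dvd h
  have hle := Nat.le_of_dvd (by norm_num) hd
  have h2' : ¬ Function.minimalPeriod f x ∣ 2 := fun hc =>
    h2 (Function.isPeriodicPt_iff_minimalPeriod_dvd.2 hc)
  have h3' : ¬ Function.minimalPeriod f x ∣ 3 := fun hc =>
    h3 (Function.isPeriodicPt_iff_minimalPeriod_dvd.2 hc)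
  interval_cases Function.minimalPeriod f x <;> simp_all

/-- The standard football graph, dual to the truncated icosahedron. -/
def standardFootball : FootballGraph FootballDart where
  rot := FootballDart.rot
  inv := FootballDart.inv
  inv_inv d := by cases d <;> simp [FootballDart.inv, icoInv_icoInv]
  inv_ne d := by cases d <;> simp [FootballDart.inv, icoInv_ne]
  black := FootballDart.black
  black_rot d := by cases d <;> rfl
  valence_black d h := by
    have five : ∀ k : ZMod 5, k + 1 + 1 + 1 + 1 + 1 = k := by decide
    cases d with
    | toFace d =>
      have : Fact (Nat.Prime 5) := ⟨Nat.prime_five⟩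
      refine Function.minimalPeriod_eq_prime (p := 5) ?_ ?_
      · obtain ⟨v, k⟩ := d
        change FootballDart.toFace (v, k + 1 + 1 + 1 + 1 + 1) = _
        rw [five k]
      · obtain ⟨v, k⟩ := d
        intro hc
        have hc' : FootballDart.toFace (v, k + 1) = FootballDart.toFace (v, k) := hc
        simp at hc'
    | toVertex d => cases h
    | across d => cases h
  inv_black d h := by cases d <;> first | rfl | cases h
  valence_white d h := by
    cases d with
    | toFace d => cases h
    | toVertex d =>
      refine minimalPeriod_eq_six ?_ ?_ ?_ <;>
        simp [FootballDart.rot, icoFace_cube, icoFace_ne]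
    | across d =>
      refine minimalPeriod_eq_six ?_ ?_ ?_ <;>
        simp [FootballDart.rot, icoFace_cube, icoFace_ne]
  alternate d h := by cases d <;> first | rfl | cases h

/-! ### Existence of the football tree

The universal covering of a football graph, made of its edge paths without backtracking. -/

namespace FootballGraph

variable {D : Type*}

/-- `w` is (in reverse order) an edge path without backtracking, starting at the origin of `d₀` and
ending at the origin of `d`. -/
def IsPathTo (G : FootballGraph D) (d₀ : D) : List D → D → Prop
  | [], d => G.SameOrigin d₀ d
  | e :: w, d => G.SameOrigin (G.inv e) d ∧ IsPathTo G d₀ w e ∧ ∀ f ∈ w.head?, e ≠ G.inv f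

theorem IsPathTo.congr {G : FootballGraph D} {d₀ : D} {w : List D} {d e : D}
    (h : G.SameOrigin d e) (hd : G.IsPathTo d₀ w d) : G.IsPathTo d₀ w e := by
  cases w with
  | nil => exact Equiv.Perm.SameCycle.trans hd h
  | cons f w => exact ⟨Equiv.Perm.SameCycle.trans hd.1 h, hd.2⟩

theorem sameOrigin_rot (G : FootballGraph D) (d : D) : G.SameOrigin d (G.rot d) := ⟨1, by simp⟩

/-- The darts of the universal covering: a vertex is a path `w`, its darts are those at the end of
`w`. -/
def CoverDart (G : FootballGraph D) (d₀ : D) : Type _ :=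
  {p : List D × D // G.IsPathTo d₀ p.1 p.2}

variable {G : FootballGraph D} {d₀ : D}

theorem CoverDart.ext {x y : G.CoverDart d₀} (h₁ : x.1.1 = y.1.1) (h₂ : x.1.2 = y.1.2) : x = y :=
  Subtype.ext (Prod.ext h₁ h₂)

/-- Cyclic order on the universal covering. -/
def coverRot (G : FootballGraph D) (d₀ : D) : Equiv.Perm (G.CoverDart d₀) where
  toFun x := ⟨(x.1.1, G.rot x.1.2), x.2.congr (G.sameOrigin_rot _)⟩
  invFun x := ⟨(x.1.1, G.rot.symm x.1.2), x.2.congr ⟨-1, by simp⟩⟩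
  left_inv x := CoverDart.ext rfl (by simp)
  right_inv x := CoverDart.ext rfl (by simp)

open Classical in
/-- Edge inversion on the universal covering: prolong the path by `d`, or delete its last edge if
that is `d` reversed. -/
noncomputable def coverInv (G : FootballGraph D) (d₀ : D) : G.CoverDart d₀ → G.CoverDart d₀
  | ⟨([], d), h⟩ => ⟨([d], G.inv d), Equiv.Perm.SameCycle.refl _ _, h, by simp⟩
  | ⟨(e :: w, d), h⟩ =>
    if hd : d = G.inv e then ⟨(w, e), h.2.1⟩
    else ⟨(d :: e :: w, G.inv d), Equiv.Perm.SameCycle.refl _ _, h, by simpa using hd⟩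

/-- Going along `x` prolongs the path. -/
def CoverDart.Up (x : G.CoverDart d₀) : Prop := ∀ e ∈ x.1.1.head?, x.1.2 ≠ G.inv e

theorem coverInv_of_up {x : G.CoverDart d₀} (h : x.Up) :
    (G.coverInv d₀ x).1 = (x.1.2 :: x.1.1, G.inv x.1.2) := by
  obtain ⟨⟨_ | ⟨e, w⟩, d⟩, hx⟩ := x
  · rfl
  · have hd : d ≠ G.inv e := h e (by simp)
    simp [coverInv, hd]

theorem exists_of_not_up {x : G.CoverDart d₀} (h : ¬ x.Up) :
    ∃ e w, x.1 = (e :: w, G.inv e) ∧ (G.coverInv d₀ x).1 = (w, e) := by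
  obtain ⟨⟨_ | ⟨e, w⟩, d⟩, hx⟩ := x
  · exact absurd (by simp [CoverDart.Up]) h
  · have hd : d = G.inv e := by
      by_contra hd
      exact h (by simpa [CoverDart.Up] using hd)
    subst hd
    exact ⟨e, w, rfl, by simp [coverInv]⟩

theorem up_coverInv {x : G.CoverDart d₀} (h : ¬ x.Up) : (G.coverInv d₀ x).Up := by
  obtain ⟨e, w, h1, h2⟩ := exists_of_not_up h
  have hx := x.2
  rw [h1] at hx
  intro f hf
  rw [h2] at hf ⊢
  exact hx.2.2 f hf

theorem coverInv_coverInv (x : G.CoverDart d₀) : G.coverInv d₀ (G.coverInv d₀ x) = x := by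
  by_cases h : x.Up
  · have h1 := coverInv_of_up h
    have h2 : ¬ (G.coverInv d₀ x).Up := by
      intro hu
      rw [CoverDart.Up, h1] at hu
      exact hu x.1.2 (by simp) rfl
    obtain ⟨e, w, h3, h4⟩ := exists_of_not_up h2
    rw [h1] at h3
    simp only [Prod.mk.injEq, List.cons.injEq] at h3
    exact Subtype.ext (by rw [h4, ← h3.1.1, ← h3.1.2])
  · obtain ⟨e, w, h1, h2⟩ := exists_of_not_up h
    have h3 := coverInv_of_up (up_coverInv h)
    exact Subtype.ext (by rw [h3, h1, h2])

theorem coverInv_snd (x : G.CoverDart d₀) : (G.coverInv d₀ x).1.2 = G.inv x.1.2 := by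
  by_cases h : x.Up
  · rw [coverInv_of_up h]
  · obtain ⟨e, w, h1, h2⟩ := exists_of_not_up h
    rw [h1, h2, G.inv_inv]

theorem minimalPeriod_coverRot (x : G.CoverDart d₀) :
    Function.minimalPeriod (G.coverRot d₀) x = Function.minimalPeriod G.rot x.1.2 := by
  have key : ∀ n : ℕ, ((G.coverRot d₀)^[n] x).1 = (x.1.1, G.rot^[n] x.1.2) := by
    intro n
    induction n with
    | zero => rfl
    | succ n ih =>
      rw [Function.iterate_succ_apply', Function.iterate_succ_apply']
      change (_, _) = _
      rw [ih]
  rw [Function.minimalPeriod_eq_minimalPeriod_iff]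
  intro n
  constructor
  · intro h
    have := key n
    rw [show (G.coverRot d₀)^[n] x = x from h] at this
    exact (congrArg Prod.snd this).symm
  · intro h
    refine Subtype.ext ?_
    rw [key n, show G.rot^[n] x.1.2 = x.1.2 from h]

/-- The universal covering of the component of `d₀`. -/
noncomputable def universalCover (G : FootballGraph D) (d₀ : D) :
    FootballGraph (G.CoverDart d₀) where
  rot := G.coverRot d₀
  inv := G.coverInv d₀
  inv_inv := coverInv_coverInv
  inv_ne x hx := by
    have := congrArg (fun y : G.CoverDart d₀ => y.1.2) hx
    simp only [coverInv_snd] at this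
    exact G.inv_ne _ this
  black x := G.black x.1.2
  black_rot x := G.black_rot _
  valence_black x h := by rw [minimalPeriod_coverRot]; exact G.valence_black _ h
  inv_black x h := by rw [coverInv_snd]; exact G.inv_black _ h
  valence_white x h := by rw [minimalPeriod_coverRot]; exact G.valence_white _ h
  alternate x h := by rw [coverInv_snd, coverInv_snd]; exact G.alternate _ h

theorem universalCover_sameOrigin {x y : G.CoverDart d₀} (h : (G.universalCover d₀).SameOrigin x y) :
    x.1.1 = y.1.1 := by
  obtain ⟨n, rfl⟩ := h
  have key : ∀ z : G.CoverDart d₀, (G.coverRot d₀ z).1.1 = z.1.1 := fun z => rfl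
  have key' : ∀ z : G.CoverDart d₀, ((G.coverRot d₀)⁻¹ z).1.1 = z.1.1 := fun z => rfl
  change _ = (((G.coverRot d₀) ^ n) x).1.1
  induction n with
  | zero => rfl
  | succ n ih => rw [add_comm, zpow_add, zpow_one, Equiv.Perm.mul_apply, key, ← ih]
  | pred n ih =>
    rw [sub_eq_add_neg, add_comm, zpow_add, zpow_neg_one, Equiv.Perm.mul_apply, key', ← ih]

theorem sameOrigin_universalCover {x y : G.CoverDart d₀} (h : x.1.1 = y.1.1)
    (h' : G.SameOrigin x.1.2 y.1.2) : (G.universalCover d₀).SameOrigin x y := by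
  obtain ⟨n, hn⟩ := h'
  refine ⟨n, ?_⟩
  have key : ∀ m : ℤ, (((G.coverRot d₀) ^ m) x).1 = (x.1.1, (G.rot ^ m) x.1.2) := by
    intro m
    induction m with
    | zero => rfl
    | succ m ih =>
      rw [add_comm, zpow_add, zpow_add, zpow_one, zpow_one, Equiv.Perm.mul_apply,
        Equiv.Perm.mul_apply]
      change (_, _) = _
      rw [ih]
    | pred m ih =>
      rw [sub_eq_add_neg, add_comm, zpow_add, zpow_add, zpow_neg_one, zpow_neg_one,
        Equiv.Perm.mul_apply, Equiv.Perm.mul_apply]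
      change (_, G.rot⁻¹ _) = _
      rw [ih]
  refine Subtype.ext ((key n).trans ?_)
  rw [hn, h]

theorem universalCover_connected : (G.universalCover d₀).Connected := by
  let base : G.CoverDart d₀ := ⟨([], d₀), Equiv.Perm.SameCycle.refl _ _⟩
  have hsymm : Std.Symm (fun x y : G.CoverDart d₀ =>
      (G.universalCover d₀).SameOrigin x y ∨ y = (G.universalCover d₀).inv x) := by
    constructor
    rintro x y (h | rfl)
    · exact Or.inl (Equiv.Perm.SameCycle.symm h)
    · exact Or.inr ((G.universalCover d₀).inv_inv x).symm
  have key : ∀ (w : List D) (d : D) (h : G.IsPathTo d₀ w d),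
      Relation.ReflTransGen (fun x y : G.CoverDart d₀ =>
        (G.universalCover d₀).SameOrigin x y ∨ y = (G.universalCover d₀).inv x) base ⟨(w, d), h⟩ := by
    intro w
    induction w with
    | nil => exact fun d h => .single (Or.inl (sameOrigin_universalCover rfl h))
    | cons e w ih =>
      intro d h
      have hu : CoverDart.Up (⟨(w, e), h.2.1⟩ : G.CoverDart d₀) := h.2.2
      refine ((ih e h.2.1).tail (Or.inr rfl)).tail (Or.inl ?_)
      have h1 := coverInv_of_up hu
      refine sameOrigin_universalCover ?_ ?_
      · change (G.coverInv d₀ _).1.1 = _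
        rw [h1]
      · change G.SameOrigin (G.coverInv d₀ _).1.2 d
        rw [h1]
        exact h.1
  refine ⟨⟨base⟩, fun x y => ?_⟩
  exact (Relation.ReflTransGen.stdSymm.symm _ _ (key x.1.1 x.1.2 x.2)).trans (key y.1.1 y.1.2 y.2)

theorem up_of_reducedStep {x y : G.CoverDart d₀} (h : (G.universalCover d₀).ReducedStep x y)
    (hx : x.Up) : y.Up := by
  by_contra hy
  obtain ⟨e, w, h1, h2⟩ := exists_of_not_up hy
  have h3 := universalCover_sameOrigin h.1
  have h4 := coverInv_of_up hx
  change (G.coverInv d₀ x).1.1 = _ at h3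
  rw [h4, h1] at h3
  simp only [List.cons.injEq] at h3
  apply h.2
  refine Subtype.ext ?_
  change _ = (G.coverInv d₀ x).1
  rw [h4, h1, h3.1, h3.2]

theorem up_getLast (l : List (G.CoverDart d₀)) : ∀ x : G.CoverDart d₀,
    List.IsChain (G.universalCover d₀).ReducedStep (x :: l) → x.Up →
      ((x :: l).getLast (List.cons_ne_nil x l)).Up ∧
      x.1.1.length < (G.coverInv d₀ ((x :: l).getLast (List.cons_ne_nil x l))).1.1.length := by
  induction l with
  | nil =>
    intro x _ hx
    refine ⟨hx, ?_⟩
    simp [coverInv_of_up hx]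
  | cons y l ih =>
    intro x h hx
    rw [List.isChain_cons_cons] at h
    obtain ⟨h1, h2⟩ := ih y h.2 (up_of_reducedStep h.1 hx)
    rw [List.getLast_cons (List.cons_ne_nil y l)]
    refine ⟨h1, lt_trans ?_ h2⟩
    rw [← universalCover_sameOrigin h.1.1]
    change _ < (G.coverInv d₀ x).1.1.length
    simp [coverInv_of_up hx]

theorem down_getLast (l : List (G.CoverDart d₀)) : ∀ x : G.CoverDart d₀,
    List.IsChain (G.universalCover d₀).ReducedStep (x :: l) →
      ¬ ((x :: l).getLast (List.cons_ne_nil x l)).Up →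
      (G.coverInv d₀ ((x :: l).getLast (List.cons_ne_nil x l))).1.1.length < x.1.1.length := by
  induction l with
  | nil =>
    intro x _ hx
    rw [List.getLast_singleton] at hx ⊢
    obtain ⟨e, w, h1, h2⟩ := exists_of_not_up hx
    simp [h1, h2]
  | cons y l ih =>
    intro x h hl
    have hx : ¬ x.Up := fun hx => hl (up_getLast _ x h hx).1
    rw [List.isChain_cons_cons] at h
    rw [List.getLast_cons (List.cons_ne_nil y l)] at hl ⊢
    refine lt_trans (ih y h.2 hl) ?_
    rw [← universalCover_sameOrigin h.1.1]
    change (G.coverInv d₀ x).1.1.length < _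
    obtain ⟨e, w, h1, h2⟩ := exists_of_not_up hx
    simp [h1, h2]

theorem universalCover_simplyConnected : (G.universalCover d₀).SimplyConnected := by
  have key : ∀ (n : ℕ) (x : G.CoverDart d₀) (l : List (G.CoverDart d₀)), l.length = n →
      List.IsChain (G.universalCover d₀).ReducedStep (x :: l) →
      (G.coverInv d₀ ((x :: l).getLast (List.cons_ne_nil x l))).1.1 ≠ x.1.1 := by
    intro n
    induction n using Nat.strong_induction_on with
    | _ n ih =>
    intro x l hn h heq
    have hx : ¬ x.Up := fun hx => by
      have := (up_getLast l x h hx).2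
      rw [heq] at this
      exact lt_irrefl _ this
    have hl : ((x :: l).getLast (List.cons_ne_nil x l)).Up := by
      by_contra hl
      have := down_getLast l x h hl
      rw [heq] at this
      exact lt_irrefl _ this
    rcases List.eq_nil_or_concat l with rfl | ⟨m, z, rfl⟩
    · exact hx hl
    have hz : (x :: (m ++ [z])).getLast (List.cons_ne_nil _ _) = z := by
      rw [List.getLast_cons (by simp), List.getLast_append_singleton]
    have hzx : z = (G.universalCover d₀).inv x := by
      simp only [List.concat_eq_append, hz] at hl heq
      obtain ⟨e, w, h1, h2⟩ := exists_of_not_up hx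
      rw [coverInv_of_up hl, h1] at heq
      simp only [List.cons.injEq] at heq
      refine Subtype.ext ?_
      change _ = (G.coverInv d₀ x).1
      rw [h2]
      exact Prod.ext heq.2 heq.1
    simp only [List.concat_eq_append] at h hn
    cases m with
    | nil =>
      simp only [List.nil_append, List.isChain_cons_cons] at h
      exact h.1.2 hzx
    | cons y m =>
      have h' := h
      rw [List.cons_append, List.isChain_cons_cons, ← List.cons_append, List.isChain_append] at h'
      obtain ⟨h1, h2, -, h3⟩ := h'
      refine ih m.length ?_ y m rfl h2 ?_
      · rw [← hn]; simp
      · have h4 := h3 _ (List.getLast_mem_getLast? (List.cons_ne_nil y m)) z (by simp)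
        have h5 := universalCover_sameOrigin h4.1
        have h6 := universalCover_sameOrigin h1.1
        rw [hzx] at h5
        exact h5.trans h6
  intro x l h hc
  exact key l.length x l rfl h (universalCover_sameOrigin hc)

end FootballGraph

/-- Football trees exist. -/
theorem exists_footballTree :
    ∃ (D : Type) (T : FootballGraph D), T.IsFootballTree :=
  ⟨_, standardFootball.universalCover (.toFace (.north, 0)),
    FootballGraph.universalCover_connected, FootballGraph.universalCover_simplyConnected⟩

/-! ### The icosahedral group and the standard football -/

/-! The rotation group `A₅` acts simply transitively on the sixty darts of the icosahedron. The
bijection `icoLabel` makes this explicit: `icoRot` and `icoInv` become right multiplication by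
`icoTurn` and `icoFlip`, while rotations act by left multiplication.

Each dart of the standard football is determined by an icosahedral dart and by its type, i.e. the
colours of its two ends, and its rotation and inversion act on labels by right factors depending
only on the type. Given a covering `p` and an automorphism `φ`, which preserves types, the quotient
of the labels of `p (φ d)` and `p d` is therefore the same for all `d` (`Covering.icoLabel_aut`).
This defines the homomorphism `Covering.icoHom` to `A₅`. Its kernel is the deck group, hence normal
(`Covering.ker_icoHom`).

Surjectivity needs enough automorphisms: a football tree maps to every football graph, with a
prescribed image of one dart of the same type (`IsFootballTree.exists_map`), because a component of
the fibre product projects bijectively onto the tree. The same lemma yields a covering of the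
standard football. -/

/-- The rotation of the icosahedron by `72` degrees, as an even permutation. -/
def icoTurn : alternatingGroup (Fin 5) := ⟨finRotate 5, Equiv.Perm.mem_alternatingGroup.2 (by decide)⟩

/-- The rotation of the icosahedron by `180` degrees about the midpoint of an edge, as an even
permutation. -/
def icoFlip : alternatingGroup (Fin 5) := 
  ⟨Equiv.swap 1 2 * Equiv.swap 3 4, Equiv.Perm.mem_alternatingGroup.2 (by decide)⟩

/-- The rotation of the icosahedron taking the first edge at the north pole to the first edge
at `v`. -/
def icoVertexLabel : IcoVertex → alternatingGroup (Fin 5)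
  | .north => 1
  | .south => icoFlip * icoTurn ^ 3 * icoFlip * icoTurn ^ 2 * icoFlip
  | .upper i => icoTurn ^ i.val * icoFlip
  | .lower i => icoTurn ^ i.val * icoFlip * icoTurn ^ 3 * icoFlip * icoTurn ^ 2

/-- The rotation of the icosahedron taking the first edge at the north pole to `d`. -/
def icoLabel (d : IcoDart) : alternatingGroup (Fin 5) :=
  icoVertexLabel d.1 * icoTurn ^ d.2.val

theorem icoLabel_rot (d : IcoDart) : icoLabel (icoRot d) = icoLabel d * icoTurn := by
  -- The wrap-around `4 + 1 = 0` is where `icoTurn ^ 5 = 1` enters.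
  have h : ∀ k : ZMod 5, icoTurn ^ (k + 1).val = icoTurn ^ k.val * icoTurn := by decide
  obtain ⟨v, k⟩ := d
  change icoVertexLabel v * icoTurn ^ (k + 1).val = icoVertexLabel v * icoTurn ^ k.val * icoTurn
  rw [h, mul_assoc]

-- A finite check. The words in `icoVertexLabel` spell paths from `(.north, 0)`: a flip crosses to
-- `upper i`, then turn³, flip, turn² lead to `(.lower i, 0)`, and one more flip from `(.lower 0,
-- 0)` reaches the south pole.
set_option maxRecDepth 100000 in
theorem icoLabel_inv (d : IcoDart) : icoLabel (icoInv d) = icoLabel d * icoFlip := by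
  obtain ⟨v, k⟩ := d
  cases v with
  | north => revert k; decide
  | south => revert k; decide
  | upper i => revert i k; decide
  | lower i => revert i k; decide

/-- The icosahedron is connected: rotation sweeps out a star, and inversion passes from the north
pole to the upper pentagon, the lower pentagon and the south pole. -/
theorem icoDart_induction {P : IcoDart → Prop} (h₀ : P (.north, 0))
    (hrot : ∀ d, P d → P (icoRot d)) (hinv : ∀ d, P d → P (icoInv d)) (d : IcoDart) : P d := by
  have star : ∀ v k, P (v, k) → ∀ j, P (v, j) := by
    intro v k h j
    have key : ∀ n : ℕ, P (v, k + n) := by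
      intro n
      induction n with
      | zero => simpa using h
      | succ n ih =>
        have := hrot _ ih
        change P (v, k + n + 1) at this
        rwa [Nat.cast_succ, ← add_assoc]
    have := key (j - k).val
    rwa [ZMod.natCast_zmod_val, add_sub_cancel] at this
  have north := star _ _ h₀
  have upper : ∀ i j, P (.upper i, j) := fun i => star _ _ (hinv _ (north i))
  have lower : ∀ i j, P (.lower i, j) := fun i => star _ _ (hinv _ (upper i 3))
  have south := star _ _ (hinv _ (lower 0 0))
  obtain ⟨_ | _ | i | i, k⟩ := d
  exacts [north k, south k, upper i k, lower i k]

set_option maxRecDepth 100000 in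
theorem eq_of_icoLabel_eq_one {d : IcoDart} : icoLabel d = 1 → d = (.north, 0) := by
  obtain ⟨v, k⟩ := d
  cases v with
  | north => revert k; decide
  | south => revert k; decide
  | upper i => revert i k; decide
  | lower i => revert i k; decide

/-- Being alone in its fibre is passed along rotation and inversion, since these are cancellable
right translations; only the fibre over `1` needs a computation. -/
theorem icoLabel_injective : Function.Injective icoLabel := by
  suffices h : ∀ d e, icoLabel e = icoLabel d → e = d from fun d e hde => h e d hde
  refine icoDart_induction (fun e he => eq_of_icoLabel_eq_one he) (fun d ih e he => ?_)
    (fun d ih e he => ?_)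
  · obtain ⟨e, rfl⟩ := icoRot.surjective e
    rw [icoLabel_rot, icoLabel_rot, mul_left_inj] at he
    rw [ih e he]
  · obtain ⟨e, rfl⟩ : ∃ e', icoInv e' = e := ⟨_, icoInv_icoInv e⟩
    rw [icoLabel_inv, icoLabel_inv, mul_left_inj] at he
    rw [ih e he]

theorem card_alternatingGroup_five : Nat.card (alternatingGroup (Fin 5)) = 60 := by
  rw [Nat.card_eq_fintype_card, card_alternatingGroup]
  rfl

theorem icoLabel_surjective : Function.Surjective icoLabel := by
  -- An injective parametrization by a type with 60 elements suffices: the composite with `icoLabel`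
  -- is then bijective by counting.
  let f : (Fin 2 ⊕ (Fin 2 × ZMod 5)) × ZMod 5 → IcoDart := fun x =>
    (Sum.elim (fun a => if a = 0 then .north else .south)
      (fun y => if y.1 = 0 then .upper y.2 else .lower y.2) x.1, x.2)
  have hf : Function.Injective f := by
    rintro ⟨a | ⟨a, i⟩, j⟩ ⟨b | ⟨b, k⟩, l⟩ h <;> fin_cases a <;> fin_cases b <;> simp_all [f]
  have h := (Fintype.bijective_iff_injective_and_card (icoLabel ∘ f)).2
    ⟨icoLabel_injective.comp hf, by
      rw [← Nat.card_eq_fintype_card (α := alternatingGroup (Fin 5)), card_alternatingGroup_five]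
      rfl⟩
  exact h.2.of_comp

namespace FootballDart

/-- The oriented edge of the icosahedron from which a dart of the standard football arises. -/
def ico : FootballDart → IcoDart
  | toFace d => d
  | toVertex d => d
  | across d => d

end FootballDart

/-! ### Types of darts and rigidity of structure-preserving maps -/

namespace FootballGraph

variable {D E : Type*}

/-- Two darts of football graphs have origins of the same colour and ends of the same colour. -/
def SameType (G : FootballGraph D) (H : FootballGraph E) (d : D) (e : E) : Prop :=
  G.black d = H.black e ∧ G.black (G.inv d) = H.black (H.inv e)

theorem sameType_rot {G : FootballGraph D} {H : FootballGraph E} {d : D} {e : E} :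
    G.SameType H (G.rot d) (H.rot e) ↔ G.SameType H d e := by
  rw [SameType, SameType, G.black_rot, H.black_rot]
  refine and_congr_right fun h => ?_
  cases hd : G.black d with
  | true =>
    rw [G.inv_black _ (by rw [G.black_rot, hd]), H.inv_black _ (by rw [H.black_rot, ← h, hd]),
      G.inv_black d hd, H.inv_black e (by rw [← h, hd])]
  | false => rw [G.alternate d hd, H.alternate e (by rw [← h, hd]), Bool.not_inj_iff]

theorem SameType.inv {G : FootballGraph D} {H : FootballGraph E} {d : D} {e : E}
    (h : G.SameType H d e) : G.SameType H (G.inv d) (H.inv e) :=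
  ⟨h.2, by rw [G.inv_inv, H.inv_inv, h.1]⟩

theorem sameType_of_black {G : FootballGraph D} {H : FootballGraph E} {d : D} {e : E}
    (hd : G.black d = true) (he : H.black e = true) : G.SameType H d e :=
  ⟨by rw [hd, he], by rw [G.inv_black d hd, H.inv_black e he]⟩

theorem Connected.exists_black {G : FootballGraph D} (h : G.Connected) :
    ∃ d, G.black d = true := by
  obtain ⟨d⟩ := h.1
  cases hd : G.black d with
  | true => exact ⟨d, hd⟩
  | false =>
    cases hi : G.black (G.inv d) with
    | true => exact ⟨_, hi⟩
    | false => exact ⟨G.inv (G.rot d), by rw [G.alternate d hd, hi]; rfl⟩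

theorem minimalPeriod_rot_eq {G : FootballGraph D} {H : FootballGraph E} {d : D} {e : E}
    (h : G.black d = H.black e) :
    Function.minimalPeriod G.rot d = Function.minimalPeriod H.rot e := by
  cases hd : G.black d with
  | true => rw [G.valence_black d hd, H.valence_black e (by rw [← h, hd])]
  | false => rw [G.valence_white d hd, H.valence_white e (by rw [← h, hd])]

/-- The colour determines the valence. This is the source of local injectivity for colour-preserving
maps. -/
theorem rot_zpow_eq_iff {G : FootballGraph D} {H : FootballGraph E} {d : D} {e : E}
    (h : G.black d = H.black e) (n : ℤ) : (G.rot ^ n) d = d ↔ (H.rot ^ n) e = e := by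
  have h₁ := MulAction.zpow_smul_eq_iff_minimalPeriod_dvd (a := G.rot) (b := d) (n := n)
  have h₂ := MulAction.zpow_smul_eq_iff_minimalPeriod_dvd (a := H.rot) (b := e) (n := n)
  exact h₁.trans (Iff.trans (by
    rw [show Function.minimalPeriod (G.rot • ·) d = Function.minimalPeriod (H.rot • ·) e from
      minimalPeriod_rot_eq h]) h₂.symm)

/-- `hrot` is an equivalence because `SameOrigin` allows negative powers of the rotation. -/
theorem Connected.induction {G : FootballGraph D} (hG : G.Connected) {P : D → Prop} {d₀ : D}
    (h₀ : P d₀) (hrot : ∀ d, P d ↔ P (G.rot d)) (hinv : ∀ d, P d → P (G.inv d)) (d : D) :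
    P d := by
  have hz : ∀ (n : ℤ) d, P d ↔ P ((G.rot ^ n) d) := by
    intro n
    induction n with
    | zero => exact fun d => Iff.rfl
    | succ n ih => exact fun d => by rw [zpow_add_one, Equiv.Perm.mul_apply, ← ih, ← hrot]
    | pred n ih =>
      intro d
      rw [zpow_sub_one, Equiv.Perm.mul_apply, ← ih, hrot (G.rot⁻¹ d),
        show G.rot (G.rot⁻¹ d) = d from G.rot.apply_symm_apply d]
  induction hG.2 d₀ d with
  | refl => exact h₀
  | tail _ h ih =>
    obtain ⟨n, rfl⟩ | rfl := h
    · exact (hz n _).1 ih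
    · exact hinv _ ih

theorem rot_zpow_comm {G : FootballGraph D} {H : FootballGraph E} {f : D → E}
    (hf : ∀ d, f (G.rot d) = H.rot (f d)) (n : ℤ) (d : D) :
    f ((G.rot ^ n) d) = (H.rot ^ n) (f d) := by
  induction n generalizing d with
  | zero => rfl
  | succ n ih => rw [zpow_add_one, zpow_add_one, Equiv.Perm.mul_apply, Equiv.Perm.mul_apply, ih, hf]
  | pred n ih =>
    rw [zpow_sub_one, zpow_sub_one, Equiv.Perm.mul_apply, Equiv.Perm.mul_apply, ih]
    congr 1
    rw [Equiv.Perm.eq_inv_iff_eq, ← hf, show G.rot (G.rot⁻¹ d) = d from G.rot.apply_symm_apply d]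

/-- Maps compatible with all structure which agree at one dart of a connected graph are equal. -/
theorem Connected.map_ext {G : FootballGraph D} (hG : G.Connected) {H : FootballGraph E}
    {f g : D → E} (hf : ∀ d, f (G.rot d) = H.rot (f d)) (hf' : ∀ d, f (G.inv d) = H.inv (f d))
    (hg : ∀ d, g (G.rot d) = H.rot (g d)) (hg' : ∀ d, g (G.inv d) = H.inv (g d)) {d₀ : D}
    (h₀ : f d₀ = g d₀) : f = g := by
  funext d
  refine hG.induction (P := fun d => f d = g d) h₀ (fun d => ?_) (fun d hd => ?_) d
  · rw [hf, hg, H.rot.injective.eq_iff]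
  · rw [hf', hg', hd]

/-! ### Lifting to the football tree -/

/-- The rotation of the fibre product of two football graphs. -/
def prodRot (G : FootballGraph D) (H : FootballGraph E) :
    Equiv.Perm {x : D × E // G.SameType H x.1 x.2} where
  toFun x := ⟨(G.rot x.1.1, H.rot x.1.2), sameType_rot.2 x.2⟩
  invFun x := ⟨(G.rot.symm x.1.1, H.rot.symm x.1.2), by
    rw [← sameType_rot, Equiv.apply_symm_apply, Equiv.apply_symm_apply]
    exact x.2⟩
  left_inv x := Subtype.ext (Prod.ext (G.rot.symm_apply_apply _) (H.rot.symm_apply_apply _))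
  right_inv x := Subtype.ext (Prod.ext (G.rot.apply_symm_apply _) (H.rot.apply_symm_apply _))

/-- Both coordinates have origins of one colour, hence equal periods, so the pair has that period
too. -/
theorem minimalPeriod_prodRot (G : FootballGraph D) (H : FootballGraph E)
    (x : {x : D × E // G.SameType H x.1 x.2}) :
    Function.minimalPeriod (G.prodRot H) x = Function.minimalPeriod G.rot x.1.1 := by
  have key : ∀ n : ℕ, ((G.prodRot H)^[n] x).1 = (G.rot^[n] x.1.1, H.rot^[n] x.1.2) := by
    intro n
    induction n with
    | zero => rfl
    | succ n ih =>
      rw [Function.iterate_succ_apply', Function.iterate_succ_apply', Function.iterate_succ_apply']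
      change (G.rot _, H.rot _) = _
      rw [ih]
  rw [Function.minimalPeriod_eq_minimalPeriod_iff]
  intro n
  constructor
  · intro h
    have := key n
    rw [show (G.prodRot H)^[n] x = x from h] at this
    exact (congrArg Prod.fst this).symm
  · intro h
    have h' : Function.IsPeriodicPt H.rot n x.1.2 := by
      rw [Function.isPeriodicPt_iff_minimalPeriod_dvd] at h ⊢
      rwa [← minimalPeriod_rot_eq x.2.1]
    refine Subtype.ext ?_
    rw [key n, show G.rot^[n] x.1.1 = x.1.1 from h, show H.rot^[n] x.1.2 = x.1.2 from h']

/-- The fibre product of two football graphs. -/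
def prod (G : FootballGraph D) (H : FootballGraph E) :
    FootballGraph {x : D × E // G.SameType H x.1 x.2} where
  rot := G.prodRot H
  inv x := ⟨(G.inv x.1.1, H.inv x.1.2), x.2.inv⟩
  inv_inv _ := Subtype.ext (Prod.ext (G.inv_inv _) (H.inv_inv _))
  inv_ne x h := G.inv_ne x.1.1 (congrArg (fun y => y.1.1) h)
  black x := G.black x.1.1
  black_rot x := G.black_rot x.1.1
  valence_black x h := (minimalPeriod_prodRot G H x).trans (G.valence_black x.1.1 h)
  inv_black x h := G.inv_black x.1.1 h
  valence_white x h := (minimalPeriod_prodRot G H x).trans (G.valence_white x.1.1 h)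
  alternate x h := G.alternate x.1.1 h

/-! ### Local injectivity and paths without backtracking -/

theorem SameOrigin.map {G : FootballGraph D} {H : FootballGraph E} {f : D → E}
    (hf : ∀ d, f (G.rot d) = H.rot (f d)) {x y : D} (h : G.SameOrigin x y) :
    H.SameOrigin (f x) (f y) := by
  obtain ⟨n, rfl⟩ := h
  exact ⟨n, (rot_zpow_comm hf n x).symm⟩

theorem eq_of_sameOrigin {G : FootballGraph D} {H : FootballGraph E} {f : D → E}
    (hf : ∀ d, f (G.rot d) = H.rot (f d)) (hb : ∀ d, H.black (f d) = G.black d) {x y : D}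
    (h : G.SameOrigin x y) (hxy : f x = f y) : x = y := by
  obtain ⟨n, rfl⟩ := h
  rw [rot_zpow_comm hf] at hxy
  exact ((rot_zpow_eq_iff (hb x).symm n).2 hxy.symm).symm

/-- Injectivity on stars prevents the image from backtracking where the original does not. -/
theorem ReducedStep.map {G : FootballGraph D} {H : FootballGraph E} {f : D → E}
    (hf : ∀ d, f (G.rot d) = H.rot (f d)) (hf' : ∀ d, f (G.inv d) = H.inv (f d))
    (hb : ∀ d, H.black (f d) = G.black d) {x y : D} (h : G.ReducedStep x y) :
    H.ReducedStep (f x) (f y) := by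
  rw [ReducedStep, ← hf']
  exact ⟨h.1.map hf, fun hc => h.2 (eq_of_sameOrigin hf hb h.1 hc.symm).symm⟩

/-- Darts in the same component which have different origins are joined by a path without
backtracking. -/
theorem exists_reduced_path (G : FootballGraph D) {x y : D}
    (h : Relation.ReflTransGen (fun x y => G.SameOrigin x y ∨ y = G.inv x) x y) :
    G.SameOrigin x y ∨ ∃ (d : D) (l : List D), List.IsChain G.ReducedStep (d :: l) ∧
      G.SameOrigin x d ∧ G.SameOrigin (G.inv ((d :: l).getLast (List.cons_ne_nil d l))) y := by
  induction h using Relation.ReflTransGen.head_induction_on with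
  | refl => exact Or.inl (Equiv.Perm.SameCycle.refl _ _)
  | @head x z hxz _ ih =>
    obtain hxz | rfl := hxz
    · obtain ih | ⟨d, l, hl, hd, hy⟩ := ih
      · exact Or.inl (Equiv.Perm.SameCycle.trans hxz ih)
      · exact Or.inr ⟨d, l, hl, Equiv.Perm.SameCycle.trans hxz hd, hy⟩
    · obtain ih | ⟨d, l, hl, hd, hy⟩ := ih
      · exact Or.inr ⟨x, [], List.isChain_singleton x, Equiv.Perm.SameCycle.refl _ _, ih⟩
      -- Prepending `x` either keeps the path reduced or cancels against its first edge `d`.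
      · by_cases hdx : d = G.inv x
        · subst hdx
          cases l with
          | nil =>
            rw [List.getLast_singleton, G.inv_inv] at hy
            exact Or.inl hy
          | cons e l =>
            rw [List.isChain_cons_cons] at hl
            rw [List.getLast_cons (List.cons_ne_nil e l)] at hy
            refine Or.inr ⟨e, l, hl.2, ?_, hy⟩
            have := hl.1.1
            rwa [G.inv_inv] at this
        · refine Or.inr ⟨x, d :: l, List.isChain_cons_cons.2 ⟨⟨hd, hdx⟩, hl⟩,
            Equiv.Perm.SameCycle.refl _ _, ?_⟩
          rwa [List.getLast_cons (List.cons_ne_nil d l)]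

/-- A map to a simply connected football graph is injective on every component. -/
theorem SimplyConnected.eq_of_reflTransGen {G : FootballGraph D} {H : FootballGraph E}
    (hH : H.SimplyConnected) {f : D → E} (hf : ∀ d, f (G.rot d) = H.rot (f d))
    (hf' : ∀ d, f (G.inv d) = H.inv (f d)) (hb : ∀ d, H.black (f d) = G.black d) {x y : D}
    (h : Relation.ReflTransGen (fun x y => G.SameOrigin x y ∨ y = G.inv x) x y)
    (hxy : f x = f y) : x = y := by
  obtain h | ⟨d, l, hl, hd, hy⟩ := G.exists_reduced_path h
  · exact eq_of_sameOrigin hf hb h hxy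
  -- Since `f x = f y`, the image of the reduced path is closed and still reduced.
  · refine absurd ?_ (hH (f d) (l.map f) ?_)
    · have h₁ := hd.map hf
      have h₂ := hy.map hf
      rw [hf', ← hxy] at h₂
      simp only [← List.map_cons, List.getLast_map]
      exact Equiv.Perm.SameCycle.trans h₂ h₁
    · rw [← List.map_cons]
      exact List.isChain_map_of_isChain f (fun _ _ h => h.map hf hf' hb) hl

/-- Universal property of the football tree. -/
theorem IsFootballTree.exists_map {T : FootballGraph D} (hT : T.IsFootballTree)
    {H : FootballGraph E} {d : D} {e : E} (h : T.SameType H d e) :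
    ∃ f : D → E, f d = e ∧ (∀ x, f (T.rot x) = H.rot (f x)) ∧
      (∀ x, f (T.inv x) = H.inv (f x)) ∧ ∀ x, H.black (f x) = T.black x := by
  -- `R` cuts out the component of `(d, e)` in the fibre product. Its projection to `T` is onto by
  -- `ex` and injective by `uniq`; the desired map is the inverse followed by the second projection.
  let R := Relation.ReflTransGen
    (fun x y => (T.prod H).SameOrigin x y ∨ y = (T.prod H).inv x)
  let x₀ : {x : D × E // T.SameType H x.1 x.2} := ⟨(d, e), h⟩
  have ex : ∀ a, ∃ x, x.1.1 = a ∧ R x₀ x := by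
    refine hT.connected.induction (d₀ := d) ⟨x₀, rfl, .refl⟩ (fun a => ⟨?_, ?_⟩) ?_
    · rintro ⟨x, rfl, hx⟩
      exact ⟨(T.prod H).rot x, rfl, hx.tail (Or.inl (sameOrigin_rot _ _))⟩
    · rintro ⟨x, hxa, hx⟩
      refine ⟨(T.prod H).rot.symm x, ?_, hx.tail (Or.inl ⟨-1, by simp⟩)⟩
      change T.rot.symm x.1.1 = a
      rw [hxa, Equiv.symm_apply_apply]
    · rintro a ⟨x, rfl, hx⟩
      exact ⟨(T.prod H).inv x, rfl, hx.tail (Or.inr rfl)⟩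
  have symm : ∀ {x y}, R x y → R y x := by
    have : Std.Symm (fun x y => (T.prod H).SameOrigin x y ∨ y = (T.prod H).inv x) := by
      constructor
      rintro x y (h | rfl)
      · exact Or.inl (Equiv.Perm.SameCycle.symm h)
      · exact Or.inr ((T.prod H).inv_inv x).symm
    intro x y h
    exact Relation.ReflTransGen.stdSymm.symm _ _ h
  have uniq : ∀ {x y}, R x₀ x → R x₀ y → x.1.1 = y.1.1 → x = y := fun hx hy hxy =>
    hT.simplyConnected.eq_of_reflTransGen (f := fun x => x.1.1) (G := T.prod H)
      (fun _ => rfl) (fun _ => rfl) (fun _ => rfl) ((symm hx).trans hy) hxy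
  choose s hs hs' using ex
  have key : ∀ x a, R x₀ x → x.1.1 = a → (s a).1.2 = x.1.2 := fun x a hx hxa => by
    rw [uniq hx (hs' a) (hxa.trans (hs a).symm)]
  refine ⟨fun a => (s a).1.2, key x₀ d .refl rfl, fun a => ?_, fun a => ?_, fun a => ?_⟩
  · refine key ((T.prod H).rot (s a)) _ ((hs' a).tail (Or.inl (sameOrigin_rot _ _))) ?_
    change T.rot (s a).1.1 = _
    rw [hs]
  · refine key ((T.prod H).inv (s a)) _ ((hs' a).tail (Or.inr rfl)) ?_
    change T.inv (s a).1.1 = _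
    rw [hs]
  · have := (s a).2.1
    rw [hs] at this
    exact this.symm

/-- The universal property gives maps both ways; they are mutually inverse by `Connected.map_ext`.
-/
theorem IsFootballTree.exists_aut {T : FootballGraph D} (hT : T.IsFootballTree) {d e : D}
    (h : T.SameType T d e) : ∃ φ : T.Aut, φ.1 d = e := by
  obtain ⟨f, hf, hf₁, hf₂, hf₃⟩ := hT.exists_map h
  obtain ⟨g, hg, hg₁, hg₂, -⟩ := hT.exists_map (⟨h.1.symm, h.2.symm⟩ : T.SameType T e d)
  have hgf : g ∘ f = id := hT.connected.map_ext (H := T) (d₀ := d) (by simp [hf₁, hg₁])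
    (by simp [hf₂, hg₂]) (fun _ => rfl) (fun _ => rfl) (by simp [hf, hg])
  have hfg : f ∘ g = id := hT.connected.map_ext (H := T) (d₀ := e) (by simp [hf₁, hg₁])
    (by simp [hf₂, hg₂]) (fun _ => rfl) (fun _ => rfl) (by simp [hf, hg])
  exact ⟨⟨⟨f, g, congrFun hgf, congrFun hfg⟩, fun x => ⟨hf₁ x, hf₂ x, hf₃ x⟩⟩, hf⟩

theorem bijOn_star_of_map {G : FootballGraph D} {H : FootballGraph E} {f : D → E}
    (hf : ∀ d, f (G.rot d) = H.rot (f d)) (hb : ∀ d, H.black (f d) = G.black d) (d : D) :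
    Set.BijOn f {e | G.SameOrigin d e} {e | H.SameOrigin (f d) e} := by
  refine ⟨fun e he => SameOrigin.map hf he, fun x hx y hy hxy => ?_, ?_⟩
  · exact eq_of_sameOrigin hf hb (Equiv.Perm.SameCycle.trans (Equiv.Perm.SameCycle.symm hx) hy) hxy
  · rintro _ ⟨n, rfl⟩
    exact ⟨(G.rot ^ n) d, ⟨n, rfl⟩, rot_zpow_comm hf n d⟩

/-! ### Coverings of the standard football -/

theorem surjective_of_map {G : FootballGraph D} {f : D → FootballDart}
    (hf : ∀ d, f (G.rot d) = standardFootball.rot (f d))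
    (hf' : ∀ d, f (G.inv d) = standardFootball.inv (f d)) {d₀ : D}
    (h₀ : f d₀ = .toFace (.north, 0)) : Function.Surjective f := by
  have hrot : ∀ {x}, x ∈ Set.range f → FootballDart.rot x ∈ Set.range f := by
    rintro _ ⟨d, rfl⟩
    exact ⟨_, hf d⟩
  have hinv : ∀ {x}, x ∈ Set.range f → FootballDart.inv x ∈ Set.range f := by
    rintro _ ⟨d, rfl⟩
    exact ⟨_, hf' d⟩
  have htoFace : ∀ d, FootballDart.toFace d ∈ Set.range f := by
    refine icoDart_induction ⟨d₀, h₀⟩ (fun d h => hrot h) (fun d h => ?_)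
    -- Walk from `v` into the face, turn two places to its next corner, walk out and rotate: this
    -- realizes `icoInv` on pentagon darts.
    have := hrot (hinv (hrot (hrot (hinv h))))
    change FootballDart.toFace (icoRot (icoFace d)) ∈ _ at this
    rwa [icoFace, Equiv.apply_symm_apply] at this
  rintro (d | d | d)
  · exact htoFace d
  · exact hinv (htoFace d)
  · exact hrot (hinv (htoFace d))

theorem IsFootballTree.nonempty_covering {T : FootballGraph D} (hT : T.IsFootballTree) :
    Nonempty (T.Covering standardFootball) := by
  obtain ⟨d, hd⟩ := hT.connected.exists_black
  obtain ⟨f, hf, hf₁, hf₂, hf₃⟩ := hT.exists_map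
    (sameType_of_black (H := standardFootball) (e := .toFace (.north, 0)) hd rfl)
  exact ⟨⟨f, hf₁, hf₂, hf₃, bijOn_star_of_map hf₁ hf₃, surjective_of_map hf₁ hf₂ hf⟩⟩

/-- The three darts over one icosahedral dart have the distinct types black-white, white-black and
white-white. -/
theorem eq_of_ico_eq_of_sameType {x y : FootballDart} (h : x.ico = y.ico)
    (h' : standardFootball.SameType standardFootball x y) : x = y := by
  obtain ⟨h₁, h₂⟩ := h'
  change x.black = y.black at h₁
  change x.inv.black = y.inv.black at h₂
  cases x <;> cases y <;> simp_all [FootballDart.ico, FootballDart.black, FootballDart.inv]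

theorem icoLabel_face (d : IcoDart) :
    icoLabel (icoFace d) = icoLabel d * (icoFlip * icoTurn⁻¹) := by
  rw [← mul_assoc, eq_mul_inv_iff_mul_eq, ← icoLabel_rot, ← icoLabel_inv, icoFace,
    Equiv.apply_symm_apply]

/-- Rotation acts on the labels by right translations which depend only on the type. -/
theorem icoLabel_rot_mul_inv {x y : FootballDart}
    (h : standardFootball.SameType standardFootball x y) :
    icoLabel (standardFootball.rot x).ico * (icoLabel (standardFootball.rot y).ico)⁻¹ =
      icoLabel x.ico * (icoLabel y.ico)⁻¹ := by
  obtain ⟨h₁, h₂⟩ := h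
  change x.black = y.black at h₁
  change x.inv.black = y.inv.black at h₂
  change icoLabel x.rot.ico * (icoLabel y.rot.ico)⁻¹ = _
  cases x <;> cases y <;>
    simp_all [FootballDart.ico, FootballDart.black, FootballDart.inv, FootballDart.rot,
      icoLabel_face, icoLabel_rot, mul_assoc]

/-- Inversion acts on the labels by right translations which depend only on the type. -/
theorem icoLabel_inv_mul_inv {x y : FootballDart}
    (h : standardFootball.SameType standardFootball x y) :
    icoLabel (standardFootball.inv x).ico * (icoLabel (standardFootball.inv y).ico)⁻¹ =
      icoLabel x.ico * (icoLabel y.ico)⁻¹ := by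
  obtain ⟨h₁, h₂⟩ := h
  change x.black = y.black at h₁
  change x.inv.black = y.inv.black at h₂
  change icoLabel x.inv.ico * (icoLabel y.inv.ico)⁻¹ = _
  cases x <;> cases y <;>
    simp_all [FootballDart.ico, FootballDart.black, FootballDart.inv, icoLabel_inv, mul_assoc]

/-! ### The action of automorphisms on the icosahedron -/

theorem Covering.sameType_aut {G : FootballGraph D} {H : FootballGraph E} (p : G.Covering H)
    (φ : G.Aut) (d : D) : H.SameType H (p.toFun (φ.1 d)) (p.toFun d) := by
  refine ⟨?_, ?_⟩
  · rw [p.map_black, p.map_black, (φ.2 d).2.2]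
  · rw [← p.map_inv, ← p.map_inv, p.map_black, p.map_black, ← (φ.2 d).2.1, (φ.2 _).2.2]

/-- The rotation of the icosahedron induced by an automorphism does not depend on the dart at
which it is computed. -/
theorem Covering.icoLabel_aut {G : FootballGraph D} (hG : G.Connected)
    (p : G.Covering standardFootball) (φ : G.Aut) (d₀ d : D) :
    icoLabel (p.toFun (φ.1 d)).ico * (icoLabel (p.toFun d).ico)⁻¹ =
      icoLabel (p.toFun (φ.1 d₀)).ico * (icoLabel (p.toFun d₀).ico)⁻¹ := by
  refine hG.induction (P := fun d => icoLabel (p.toFun (φ.1 d)).ico *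
    (icoLabel (p.toFun d).ico)⁻¹ = icoLabel (p.toFun (φ.1 d₀)).ico *
      (icoLabel (p.toFun d₀).ico)⁻¹) rfl (fun d => ?_) (fun d hd => ?_) d
  · rw [(φ.2 d).1, p.map_rot, p.map_rot, icoLabel_rot_mul_inv (p.sameType_aut φ d)]
  · rw [(φ.2 d).2.1, p.map_inv, p.map_inv, icoLabel_inv_mul_inv (p.sameType_aut φ d), hd]

/-- The action of the automorphism group of a connected covering of the standard football on the
icosahedron. -/
def Covering.icoHom {G : FootballGraph D} (hG : G.Connected) (p : G.Covering standardFootball)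
    (d₀ : D) : G.Aut →* alternatingGroup (Fin 5) where
  toFun φ := icoLabel (p.toFun (φ.1 d₀)).ico * (icoLabel (p.toFun d₀).ico)⁻¹
  map_one' := mul_inv_cancel _
  map_mul' φ ψ := by
    -- Evaluating the factor of `φ` at `ψ d₀` makes the product telescope.
    rw [← p.icoLabel_aut hG φ d₀ (ψ.1 d₀), mul_assoc, inv_mul_cancel_left]
    rfl

theorem Covering.ker_icoHom {G : FootballGraph D} (hG : G.Connected)
    (p : G.Covering standardFootball) (d₀ : D) : (p.icoHom hG d₀).ker = p.deck := by
  ext φ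
  rw [MonoidHom.mem_ker]
  constructor
  · intro h d
    have h' := (p.icoLabel_aut hG φ d₀ d).trans h
    exact eq_of_ico_eq_of_sameType (icoLabel_injective (mul_inv_eq_one.1 h')) (p.sameType_aut φ d)
  · intro h
    exact mul_inv_eq_one.2 (by rw [h d₀])

/-- With `d₀` black, every lift of every `toFace x` has the type of `d₀`, so some automorphism takes
`d₀` there; `x` is chosen by its label. -/
theorem Covering.icoHom_surjective {T : FootballGraph D} (hT : T.IsFootballTree)
    (p : T.Covering standardFootball) {d₀ : D} (hd₀ : T.black d₀ = true) :
    Function.Surjective (p.icoHom hT.connected d₀) := by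
  intro g
  obtain ⟨x, hx⟩ := icoLabel_surjective (g * icoLabel (p.toFun d₀).ico)
  obtain ⟨d, hd⟩ := p.surjective (.toFace x)
  have hb : T.black d = true := by
    rw [← p.map_black, hd]
    rfl
  obtain ⟨φ, hφ⟩ := hT.exists_aut (sameType_of_black hd₀ hb)
  refine ⟨φ, ?_⟩
  change icoLabel (p.toFun (φ.1 d₀)).ico * _ = g
  rw [hφ, hd]
  exact mul_inv_eq_of_eq_mul hx

end FootballGraph

/-- Let `T` be the football tree.  It covers the standard football graph `Γ₀`; for every such
(universal) covering, the group `π₁(Γ₀)` of its deck transformations is normal in `Aut T`, and the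
quotient is the icosahedral group `A₅` of order `60`. -/
theorem mainTheorem3 {D : Type*} (T : FootballGraph D) (hT : T.IsFootballTree) :
    Nonempty (T.Covering standardFootball) ∧
    ∀ p : T.Covering standardFootball,
      ∃ _ : p.deck.Normal,
        Nat.card (T.Aut ⧸ p.deck) = 60 ∧
        Nonempty ((T.Aut ⧸ p.deck) ≃* alternatingGroup (Fin 5)) := by
  refine ⟨hT.nonempty_covering, fun p => ?_⟩
  obtain ⟨d, hd⟩ := hT.connected.exists_black
  have hker := p.ker_icoHom hT.connected d
  have hnormal : p.deck.Normal := hker ▸ MonoidHom.normal_ker _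
  let e : (T.Aut ⧸ p.deck) ≃* alternatingGroup (Fin 5) :=
    (QuotientGroup.quotientMulEquivOfEq hker.symm).trans
      (QuotientGroup.quotientKerEquivOfSurjective _ (p.icoHom_surjective hT hd))
  exact ⟨hnormal, (Nat.card_congr e.toEquiv).trans card_alternatingGroup_five, ⟨e⟩⟩
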